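/- Let $\mathbb{N}_0=\{0,1,2,\dots\}$. For $c\in\mathbb{N}_0$ and a finite set $P\subset\mathbb{N}_0$, let $c+\langle P\rangle=\{c+\sum_{p\in P}a_p\,p : a_p\in\mathbb{N}_0\}$ be the $1$-dimensional linear set with constant $c$ and set of periods $P$. The containment problem for $1$-dimensional linear sets with a unary encoding of numbers is the following decision problem: given $c,c'\in\mathbb{N}_0$ and finite sets $P,P'\subset\mathbb{N}_0$ (each set presented as a list of its elements), with all numbers encoded in unary, decide whether $c+\langle P\rangle\subseteq c'+\langle P'\rangle$. **Theorem.** The containment problem for $1$-dimensional linear sets with a unary encoding of numbers is in $\mathrm{P}$. That is, the language of all strings $$1^{c},1^{p_1},\dots,1^{p_k};1^{c'},1^{p'_1},\dots,1^{p'_{l}}$$ over the three-letter alphabet $\{1,\ \text{comma},\ \text{semicolon}\}$, with $k,l\ge 0$, such that $c+\langle\{p_1,\dots,p_k\}\rangle\subseteq c'+\langle\{p'_1,\dots,p'_l\}\rangle$, is decided by a deterministic Turing machine whose running time is bounded by a polynomial in the length of the input string. -/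

import Mathlib

namespace LinearSetContainment

/-- The one-dimensional linear set `c + ⟨P⟩` with constant `c` and finite set of periods `P`,
where `⟨P⟩` consists of all combinations of the periods with coefficients in `ℕ`. -/
def linearSet (c : ℕ) (P : Finset ℕ) : Set ℕ :=
  {n | ∃ a : ℕ → ℕ, n = c + ∑ p ∈ P, a p * p}

/-- The input alphabet: a unary digit and two separators. -/
inductive Sym
  | tick
  | comma
  | semicolon
  deriving DecidableEq

instance : Fintype Sym where
  elems := {Sym.tick, Sym.comma, Sym.semicolon}
  complete x := by cases x <;> simp

/-- The unary code `1^c , 1^(p₁) , … , 1^(pₖ)` of a constant `c` and a list of periods. -/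
def encodeLinear (c : ℕ) : List ℕ → List Sym
  | [] => List.replicate c Sym.tick
  | p :: ps => List.replicate c Sym.tick ++ Sym.comma :: encodeLinear p ps

/-- The unary code of an instance `(c, P, c', P')` of the containment problem, the two finite sets
`P` and `P'` being given by lists of their elements (in any order, repetitions allowed). -/
def encodeInstance (c : ℕ) (P : List ℕ) (c' : ℕ) (P' : List ℕ) : List Sym :=
  encodeLinear c P ++ Sym.semicolon :: encodeLinear c' P'

/-- The containment problem for one-dimensional linear sets with unary encoding of numbers:
the set of all codes of instances `(c, P, c', P')` such that `c + ⟨P⟩ ⊆ c' + ⟨P'⟩`.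
A string that is not the code of an instance does not belong to it. -/
def unaryContainment : Language Sym :=
  {w | ∃ (c : ℕ) (P : List ℕ) (c' : ℕ) (P' : List ℕ),
    w = encodeInstance c P c' P' ∧ linearSet c P.toFinset ⊆ linearSet c' P'.toFinset}

open Classical in
/-- The complexity class P: there is a Turing machine (with finitely many stacks, each over a finite
alphabet) that, started on an arbitrary string `w` over the input alphabet, halts after a number of
steps that is at most a polynomial in the length of `w` and outputs the truth value of `w ∈ L`. -/
def InP {Γ : Type} [Fintype Γ] (L : Language Γ) : Prop :=
  ∃ M : Turing.TM2ComputableInPolyTime (id : List Γ → List Γ) Computability.encodeBool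
      (fun w => decide (w ∈ L)),
    ∀ k : M.tm.K, Finite (M.tm.Γ k)

end LinearSetContainment

/-!
To compare `c + ⟨P⟩` with `d + ⟨Q⟩`, suppose that `Q` has a positive element `q`. By the pigeonhole
principle on partial sums modulo `q`, every element of `⟨P⟩` is a sum of fewer than `q` periods plus
a multiple of `q`, and adding a multiple of `q` does not lead out of `d + ⟨Q⟩`. Hence containment
holds as soon as every `x < (n + 1) ^ 2` in `c + ⟨P⟩` is in `d + ⟨Q⟩`, where `n` bounds all the
numbers involved; the input length is such a bound. Membership of these `x` is found by dynamic
programming: `x` lies in `c + ⟨P⟩` if and only if `x = c` or `x - p` lies in `c + ⟨P⟩` for some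
positive `p ∈ P`, `p ≤ x`. With the table of results on a stack, newest entry on top, and the
numbers in unary, reading `p` while lifting off one entry per digit leads to the entry of `x - p`.
Two stacks hold the digits of a counter to the base `n + 1` that stops the search.
-/

namespace LinearSetContainment

/-! ### Linear sets -/

theorem mem_linearSet_iff_closure {c : ℕ} {P : Finset ℕ} {x : ℕ} :
    x ∈ linearSet c P ↔ ∃ m ∈ AddSubmonoid.closure (P : Set ℕ), x = c + m := by
  constructor
  · rintro ⟨a, rfl⟩
    exact ⟨_, sum_mem fun p hp => nsmul_mem (AddSubmonoid.subset_closure hp) (a p), rfl⟩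
  · rintro ⟨m, hm, rfl⟩
    obtain ⟨a, -, rfl⟩ := AddSubmonoid.mem_closure_finset.mp hm
    exact ⟨a, rfl⟩

theorem self_mem_linearSet (c : ℕ) (P : Finset ℕ) : c ∈ linearSet c P :=
  mem_linearSet_iff_closure.mpr ⟨0, zero_mem _, rfl⟩

theorem add_mem_linearSet {c : ℕ} {P : Finset ℕ} {x m : ℕ} (hx : x ∈ linearSet c P)
    (hm : m ∈ AddSubmonoid.closure (P : Set ℕ)) : x + m ∈ linearSet c P := by
  obtain ⟨y, hy, rfl⟩ := mem_linearSet_iff_closure.mp hx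
  exact mem_linearSet_iff_closure.mpr ⟨y + m, add_mem hy hm, add_assoc c y m⟩

theorem mem_linearSet_iff_sub_mem {c : ℕ} {P : Finset ℕ} {x : ℕ} :
    x ∈ linearSet c P ↔ c = x ∨ ∃ p ∈ P, 0 < p ∧ p ≤ x ∧ x - p ∈ linearSet c P := by
  constructor
  · intro hx
    obtain ⟨m, hm, rfl⟩ := mem_linearSet_iff_closure.mp hx
    induction hm using AddSubmonoid.closure_induction_left with
    | zero => exact .inl rfl
    | add_left p hp m hm ih =>
      have hmem : c + m ∈ linearSet c P := mem_linearSet_iff_closure.mpr ⟨m, hm, rfl⟩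
      rcases Nat.eq_zero_or_pos p with rfl | hp0
      · simpa using ih hmem
      · refine .inr ⟨p, hp, hp0, by omega, ?_⟩
        rwa [show c + (p + m) - p = c + m by omega]
  · rintro (rfl | ⟨p, hp, -, hle, hx⟩)
    · exact self_mem_linearSet _ _
    · rw [← Nat.sub_add_cancel hle]
      exact add_mem_linearSet hx (AddSubmonoid.subset_closure hp)

section

variable {α M : Type*} [AddMonoid M] [Fintype M] (φ : α → M)

theorem exists_shorter_sublist_sum_map_eq {l : List α} (hl : Fintype.card M ≤ l.length) :
    ∃ l' : List α, l'.Sublist l ∧ l'.length < l.length ∧ (l'.map φ).sum = (l.map φ).sum := by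
  obtain ⟨i, j, hij, hsum⟩ := Fintype.exists_ne_map_eq_of_card_lt
    (fun i : Fin (l.length + 1) => ((l.take i).map φ).sum) (by simpa using Nat.lt_succ_of_le hl)
  wlog hlt : i < j generalizing i j
  · exact this j i hij.symm hsum.symm (lt_of_le_of_ne (not_lt.mp hlt) hij.symm)
  refine ⟨l.take i ++ l.drop j, ?_, ?_, ?_⟩
  · calc
      l.take i ++ l.drop j |>.Sublist (l.take j ++ l.drop j) :=
        (List.take_sublist_take_left hlt.le).append_right _
      _ = l := List.take_append_drop _ _
  · simp only [List.length_append, List.length_take, List.length_drop]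
    omega
  · calc
      ((l.take i ++ l.drop j).map φ).sum = ((l.take i).map φ).sum + ((l.drop j).map φ).sum := by
        simp
      _ = ((l.take j).map φ).sum + ((l.drop j).map φ).sum := by rw [hsum]
      _ = (l.map φ).sum := by
        rw [← List.sum_append, ← List.map_append, List.take_append_drop]

theorem exists_sublist_length_lt_card_sum_map_eq (l : List α) :
    ∃ l' : List α, l'.Sublist l ∧ l'.length < Fintype.card M ∧ (l'.map φ).sum = (l.map φ).sum := by
  induction hn : l.length using Nat.strong_induction_on generalizing l with
  | _ n ih =>
    by_cases hl : l.length < Fintype.card M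
    · exact ⟨l, .refl l, hl, rfl⟩
    · obtain ⟨l₁, hsub₁, hlen₁, hsum₁⟩ := exists_shorter_sublist_sum_map_eq φ (not_lt.mp hl)
      obtain ⟨l₂, hsub₂, hlen₂, hsum₂⟩ := ih _ (hn ▸ hlen₁) l₁ rfl
      exact ⟨l₂, hsub₂.trans hsub₁, hlen₂, hsum₂.trans hsum₁⟩

end

theorem exists_mem_closure_add_mul {P : Set ℕ} {n q m : ℕ} (hP : ∀ p ∈ P, p ≤ n) (hq : 0 < q)
    (hm : m ∈ AddSubmonoid.closure P) :
    ∃ y ∈ AddSubmonoid.closure P, y ≤ q * n ∧ ∃ k, m = y + k * q := by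
  have : NeZero q := ⟨hq.ne'⟩
  obtain ⟨l, hl, rfl⟩ := AddSubmonoid.exists_list_of_mem_closure hm
  obtain ⟨l', hsub, hlen, hsum⟩ :=
    exists_sublist_length_lt_card_sum_map_eq (Nat.cast : ℕ → ZMod q) l
  have hl' : ∀ p ∈ l', p ∈ P := fun p hp => hl p (hsub.subset hp)
  rw [ZMod.card] at hlen
  refine ⟨l'.sum, list_sum_mem fun p hp => AddSubmonoid.subset_closure (hl' p hp), ?_, ?_⟩
  · calc
      l'.sum ≤ l'.length • n := List.sum_le_card_nsmul _ _ fun p hp => hP p (hl' p hp)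
      _ ≤ q * n := Nat.mul_le_mul_right n hlen.le
  · have hle : l'.sum ≤ l.sum := hsub.sum_le_sum fun _ _ => zero_le
    have hmod : l'.sum ≡ l.sum [MOD q] := by
      rw [← ZMod.natCast_eq_natCast_iff]
      simpa only [Nat.cast_list_sum] using hsum
    obtain ⟨k, hk⟩ := (Nat.modEq_iff_dvd' hle).mp hmod
    exact ⟨k, by rw [mul_comm k q, ← hk, Nat.add_sub_cancel' hle]⟩

theorem linearSet_subset_of_forall_lt {c c' n : ℕ} {P P' : Finset ℕ} (hc : c ≤ n)
    (hP : ∀ p ∈ P, p ≤ n) (hP' : ∀ p ∈ P', p ≤ n)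
    (h : ∀ x < (n + 1) ^ 2, x ∈ linearSet c P → x ∈ linearSet c' P') :
    linearSet c P ⊆ linearSet c' P' := by
  intro x hx
  obtain ⟨m, hm, rfl⟩ := mem_linearSet_iff_closure.mp hx
  by_cases hq : ∃ q ∈ P', 0 < q
  · obtain ⟨q, hqP', hq0⟩ := hq
    obtain ⟨y, hy, hyn, k, rfl⟩ := exists_mem_closure_add_mul hP hq0 hm
    have hlt : c + y < (n + 1) ^ 2 := by nlinarith [hP' q hqP']
    have hmem := h _ hlt (add_mem_linearSet (self_mem_linearSet c P) hy)
    rw [← add_assoc]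
    exact add_mem_linearSet hmem (nsmul_mem (AddSubmonoid.subset_closure hqP') k)
  · have heq {y : ℕ} (hlt : y < (n + 1) ^ 2) (hy : y ∈ linearSet c P) : c' = y := by
      refine (mem_linearSet_iff_sub_mem.mp (h y hlt hy)).resolve_right ?_
      rintro ⟨q, hqP', hq0, -⟩
      exact hq ⟨q, hqP', hq0⟩
    have hclt : c < (n + 1) ^ 2 := by nlinarith
    have hPzero : (P : Set ℕ) ⊆ (⊥ : AddSubmonoid ℕ) := by
      intro p hp
      have h₀ := heq hclt (self_mem_linearSet c P)
      have h₁ := heq (y := c + p) (by nlinarith [hP p hp])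
        (add_mem_linearSet (self_mem_linearSet c P) (AddSubmonoid.subset_closure hp))
      rw [SetLike.mem_coe, AddSubmonoid.mem_bot]
      omega
    obtain rfl : m = 0 := AddSubmonoid.mem_bot.mp (AddSubmonoid.closure_le.mpr hPzero hm)
    exact h c hclt hx

/-! ### Stack machine programs -/

section Programs

variable {K Λ : Type} [DecidableEq K] {Γ : K → Type}

open Classical in
/-- Pops stack `k` and continues with `f a`, where `a` is the symbol popped, or `none` if the stack
was empty. The register of the machine, which only serves to select the continuation, is emptied. -/
noncomputable def popThen (k : K) [Fintype (Γ k)]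
    (f : Option (Γ k) → Turing.TM2.Stmt Γ Λ (Option (Σ k, Γ k))) :
    Turing.TM2.Stmt Γ Λ (Option (Σ k, Γ k)) :=
  .pop k (fun _ a => a.map (Sigma.mk k)) <|
    Finset.univ.toList.foldr
      (fun a q => .branch (fun v => v = some ⟨k, a⟩) (.load (fun _ => none) (f (some a))) q)
      (f none)

@[simp]
theorem stepAux_popThen (k : K) [Fintype (Γ k)]
    (f : Option (Γ k) → Turing.TM2.Stmt Γ Λ (Option (Σ k, Γ k))) (v : Option (Σ k, Γ k))
    (S : ∀ k, List (Γ k)) :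
    Turing.TM2.stepAux (popThen k f) v S =
      Turing.TM2.stepAux (f (S k).head?) none (Function.update S k (S k).tail) := by
  classical
  have hselect (o : Option (Γ k)) (l : List (Γ k)) (hl : ∀ a ∈ o, a ∈ l) (T) :
      Turing.TM2.stepAux (l.foldr (fun a q => .branch (fun v => v = some ⟨k, a⟩)
        (.load (fun _ => none) (f (some a))) q) (f none)) (o.map (Sigma.mk k)) T =
      Turing.TM2.stepAux (f o) none T := by
    induction l with
    | nil => cases o <;> simp_all
    | cons b l ih =>
      cases o with
      | none => simpa using ih (by simp)
      | some a =>
        rcases eq_or_ne a b with rfl | hab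
        · simp
        · simpa [hab] using ih (by simpa [hab] using hl)
  exact hselect _ _ (by simp) _

/-- Pushes a symbol, if there is one, onto stack `k`. -/
def pushOption {σ : Type} (k : K) (o : Option (Γ k)) (q : Turing.TM2.Stmt Γ Λ σ) :
    Turing.TM2.Stmt Γ Λ σ :=
  o.elim q fun a => .push k (fun _ => a) q

@[simp]
theorem stepAux_pushOption {σ : Type} (k : K) (o : Option (Γ k)) (q : Turing.TM2.Stmt Γ Λ σ)
    (v : σ) (S : ∀ k, List (Γ k)) :
    Turing.TM2.stepAux (pushOption k o q) v S =
      Turing.TM2.stepAux q v (Function.update S k (o.toList ++ S k)) := by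
  cases o <;> simp [pushOption]

end Programs

/-! ### The deciding machine -/

section Machine

/-- The stacks of the deciding machine. The input word is moved between `input` and `passed`, and
the table of membership bits between `table` and `lifted`; `inner` and `outer` are counters. -/
inductive Stack
  | input
  | passed
  | table
  | lifted
  | inner
  | outer
  | output
  deriving DecidableEq

instance : Fintype Stack where
  elems := {.input, .passed, .table, .lifted, .inner, .outer, .output}
  complete k := by cases k <;> simp

/-- The table entry of a number `y`: at `none` the bit `y = 0`, at `some s` the bit saying whether
`y` belongs to the linear set on side `s` of the instance, where `false` is left and `true` is
right. -/
abbrev Cell : Type := Option Bool → Bool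

/-- The symbols on each stack. -/
abbrev Alphabet : Stack → Type
  | .input | .passed => Sym
  | .table | .lifted => Cell
  | .inner | .outer => Unit
  | .output => Bool

instance : ∀ k, Fintype (Alphabet k)
  | .input | .passed => inferInstanceAs (Fintype Sym)
  | .table | .lifted => inferInstanceAs (Fintype Cell)
  | .inner | .outer => inferInstanceAs (Fintype Unit)
  | .output => inferInstanceAs (Fintype Bool)

/-- The control states of the deciding machine. -/
inductive Label
  | scan
  | rewind (refill : Bool)
  | walk (side : Bool) (column : Option Bool)
  | restore (side bit : Bool) (separator : Option Sym)
  | finish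
  | clear (answer : Bool)
  deriving Fintype

/-- The table entry of a number that is not yet known to belong to either linear set. -/
def unmarked (isZero : Bool) : Cell := fun column => column.isNone && isZero

/-- Adds a reason `b` for membership on side `s` to a table entry. -/
def note (s b : Bool) (a : Cell) : Cell := Function.update a (some s) (a (some s) || b)

/-- The state in which the machine continues behind a unary number on side `s`, depending on the
symbol that ended the number: numbers behind a comma are periods, looked up in the column of their
own side. -/
def afterNumber (s : Bool) : Option Sym → Label
  | none => .finish
  | some .semicolon => .walk true none
  | some _ => .walk s (some s)

/-- The program decides membership in both linear sets for the numbers `x = 0, 1, 2, …` in turn.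
The table holds the entries of `x, x - 1, …, 0`, so that lifting off one entry for each digit of a
number `p` uncovers the entry of `x - p`. -/
@[simp]
noncomputable def program : Label → Turing.TM2.Stmt Alphabet Label (Option (Σ k, Alphabet k))
  | .scan =>
    popThen .input fun
      | some a =>
        .push .passed (fun _ => a) <| .push .outer (fun _ => ()) <|
          pushOption .inner (if a = Sym.semicolon then some () else none) <|
            .goto fun _ => .scan
      | none =>
        -- The semicolons have been counted on `inner`.
        popThen .inner fun
          | none => .goto fun _ => .clear false
          | some _ => popThen .inner fun
            | none => .push .table (fun _ => unmarked true) <| .goto fun _ => .rewind true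
            | some _ => .goto fun _ => .clear false
  | .rewind refill =>
    popThen .passed fun
      | some a =>
        .push .input (fun _ => a) <| pushOption .inner (if refill then some () else none) <|
          .goto fun _ => .rewind refill
      | none => .goto fun _ => .walk false none
  | .walk s column =>
    popThen .input fun
      | some Sym.tick =>
        .push .passed (fun _ => Sym.tick) <| popThen .table fun o =>
          pushOption .lifted o <| .goto fun _ => .walk s column
      | separator =>
        pushOption .passed separator <| popThen .table fun o =>
          pushOption .table o <| .goto fun _ => .restore s (o.any (· column)) separator
  | .restore s b separator =>
    popThen .lifted fun
      | some a => .push .table (fun _ => a) <| .goto fun _ => .restore s b separator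
      | none => popThen .table fun o =>
        pushOption .table (o.map (note s b)) <| .goto fun _ => afterNumber s separator
  | .finish =>
    popThen .table fun o =>
      if o.any fun a => a (some false) && !a (some true) then .goto fun _ => .clear false
      else
        pushOption .table o <| .push .table (fun _ => unmarked false) <| popThen .inner fun
          | some _ => .goto fun _ => .rewind false
          | none => popThen .outer fun
            | some _ => .goto fun _ => .rewind true
            | none => .goto fun _ => .clear true
  | .clear b =>
    [Stack.input, .passed, .table, .lifted, .inner, .outer].foldr
      (fun k q => popThen k fun o => if o.isSome then .goto fun _ => .clear b else q)
      (.push .output (fun _ => b) .halt)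

/-- The machine deciding the containment problem. -/
noncomputable def machine : Turing.FinTM2 where
  K := Stack
  k₀ := .input
  k₁ := .output
  Γ := Alphabet
  Λ := Label
  main := .scan
  σ := Option (Σ k, Alphabet k)
  initialState := none
  Γk₀Fin := inferInstanceAs (Fintype (Alphabet .input))
  m := program

/-- The contents of all stacks. -/
structure Store where
  input : List Sym := []
  passed : List Sym := []
  table : List Cell := []
  lifted : List Cell := []
  inner : List Unit := []
  outer : List Unit := []
  output : List Bool := []

/-- A store as the family of stack contents that the semantics of stack machines refers to. -/
@[simp]
def Store.get (S : Store) : ∀ k, List (Alphabet k)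
  | .input => S.input
  | .passed => S.passed
  | .table => S.table
  | .lifted => S.lifted
  | .inner => S.inner
  | .outer => S.outer
  | .output => S.output

/-- Replaces the contents of stack `k`. -/
@[simp]
def Store.set (S : Store) : ∀ k, List (Alphabet k) → Store
  | .input, l => { S with input := l }
  | .passed, l => { S with passed := l }
  | .table, l => { S with table := l }
  | .lifted, l => { S with lifted := l }
  | .inner, l => { S with inner := l }
  | .outer, l => { S with outer := l }
  | .output, l => { S with output := l }

@[simp]
theorem Store.update_get (S : Store) (k : Stack) (l : List (Alphabet k)) :
    Function.update S.get k l = (S.set k l).get := by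
  funext k'
  cases k <;> cases k' <;> rfl

/-- The configuration in state `q`, or halted for `q = none`, with empty register. -/
noncomputable def config (q : Option Label) (S : Store) : machine.Cfg := ⟨q, none, S.get⟩

/-- `Reach n x y` says that the machine gets from `x` to `y` in at most `n` steps. -/
def Reach (n : ℕ) (x y : machine.Cfg) : Prop :=
  Nonempty (StateTransition.EvalsToInTime machine.step x (some y) n)

theorem Reach.refl (x : machine.Cfg) : Reach 0 x x := ⟨.refl _ _⟩

theorem Reach.mono {m n : ℕ} {x y : machine.Cfg} (h : Reach m x y) (hmn : m ≤ n) : Reach n x y :=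
  h.map fun e => ⟨e.toEvalsTo, e.steps_le_m.trans hmn⟩

theorem Reach.trans {m n : ℕ} {x y z : machine.Cfg} (h : Reach m x y) (h' : Reach n y z) :
    Reach (m + n) x z := by
  obtain ⟨e⟩ := h
  obtain ⟨e'⟩ := h'
  exact ⟨add_comm n m ▸ e.trans _ _ _ _ _ _ e'⟩

theorem Reach.of_stepAux {q : Label} {q' : Option Label} {S S' : Store}
    (h : Turing.TM2.stepAux (program q) none S.get = ⟨q', none, S'.get⟩) :
    Reach 1 (config (some q) S) (config q' S') :=
  ⟨⟨⟨1, congrArg some h⟩, le_rfl⟩⟩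

theorem reach_rewind (w i : List Sym) (t : List Cell) (refill : Bool) (k l : List Unit) :
    Reach (w.length + 1)
      (config (some (.rewind refill))
        { input := i, passed := w, table := t, inner := k, outer := l })
      (config (some (.walk false none))
        { input := w.reverse ++ i, table := t,
          inner := (if refill then List.replicate w.length () else []) ++ k, outer := l }) := by
  induction w generalizing i k with
  | nil => exact .of_stepAux (by simp)
  | cons a w ih =>
    have hstep : Reach 1
        (config (some (.rewind refill))
          { input := i, passed := a :: w, table := t, inner := k, outer := l })
        (config (some (.rewind refill))
          { input := a :: i, passed := w, table := t,
            inner := (if refill then [()] else []) ++ k, outer := l }) :=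
      .of_stepAux (by cases refill <;> simp)
    convert hstep.trans (ih _ _) using 1
    · simp [add_comm]
    · cases refill <;> simp [List.replicate_succ']

theorem reach_scan (w r : List Sym) (k l : List Unit) :
    Reach w.length
      (config (some .scan) { input := w, passed := r, inner := k, outer := l })
      (config (some .scan)
        { passed := w.reverse ++ r, inner := List.replicate (w.count .semicolon) () ++ k,
          outer := List.replicate w.length () ++ l }) := by
  induction w generalizing r k l with
  | nil => exact .refl _
  | cons a w ih =>
    have hstep : Reach 1
        (config (some .scan) { input := a :: w, passed := r, inner := k, outer := l })
        (config (some .scan)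
          { input := w, passed := a :: r, inner := List.replicate ([a].count .semicolon) () ++ k,
            outer := () :: l }) :=
      .of_stepAux (by cases a <;> simp)
    convert hstep.trans (ih _ _ _) using 1
    · simp [add_comm]
    · cases a <;> simp [List.replicate_succ']

theorem reach_clear (b : Bool) : ∀ (i r : List Sym) (t a : List Cell) (k l : List Unit),
    Reach (i.length + r.length + t.length + a.length + k.length + l.length + 1)
      (config (some (.clear b)) ⟨i, r, t, a, k, l, []⟩) (config none { output := [b] })
  | _ :: i, r, t, a, k, l =>
    ((Reach.of_stepAux (by simp)).trans (reach_clear b i r t a k l)).mono (by grind)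
  | [], _ :: r, t, a, k, l =>
    ((Reach.of_stepAux (by simp)).trans (reach_clear b [] r t a k l)).mono (by grind)
  | [], [], _ :: t, a, k, l =>
    ((Reach.of_stepAux (by simp)).trans (reach_clear b [] [] t a k l)).mono (by grind)
  | [], [], [], _ :: a, k, l =>
    ((Reach.of_stepAux (by simp)).trans (reach_clear b [] [] [] a k l)).mono (by grind)
  | [], [], [], [], _ :: k, l =>
    ((Reach.of_stepAux (by simp)).trans (reach_clear b [] [] [] [] k l)).mono (by grind)
  | [], [], [], [], [], _ :: l =>
    ((Reach.of_stepAux (by simp)).trans (reach_clear b [] [] [] [] [] l)).mono (by grind)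
  | [], [], [], [], [], [] => .of_stepAux (by simp)

theorem reach_ticks (s : Bool) (column : Option Bool) (p : ℕ) (i r : List Sym) (t a : List Cell)
    (k l : List Unit) :
    Reach p
      (config (some (.walk s column)) ⟨List.replicate p .tick ++ i, r, t, a, k, l, []⟩)
      (config (some (.walk s column))
        ⟨i, List.replicate p .tick ++ r, t.drop p, (t.take p).reverse ++ a, k, l, []⟩) := by
  induction p generalizing r t a with
  | zero => exact .refl _
  | succ p ih =>
    have hstep : Reach 1
        (config (some (.walk s column)) ⟨List.replicate (p + 1) .tick ++ i, r, t, a, k, l, []⟩)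
        (config (some (.walk s column))
          ⟨List.replicate p .tick ++ i, .tick :: r, t.tail, t.head?.toList ++ a, k, l, []⟩) :=
      .of_stepAux (by simp [List.replicate_succ])
    convert hstep.trans (ih _ _ _) using 1
    · exact add_comm p 1
    · cases t <;> simp [List.replicate_succ']

theorem reach_restore (s b : Bool) (separator : Option Sym) (i r : List Sym) (t a : List Cell)
    (k l : List Unit) :
    Reach (a.length + 1)
      (config (some (.restore s b separator)) ⟨i, r, t, a, k, l, []⟩)
      (config (some (afterNumber s separator))
        ⟨i, r, (a.reverse ++ t).modifyHead (note s b), [], k, l, []⟩) := by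
  induction a generalizing t with
  | nil => exact .of_stepAux (by cases t <;> simp)
  | cons y a ih =>
    have hstep : Reach 1
        (config (some (.restore s b separator)) ⟨i, r, t, y :: a, k, l, []⟩)
        (config (some (.restore s b separator)) ⟨i, r, y :: t, a, k, l, []⟩) :=
      .of_stepAux (by simp)
    convert hstep.trans (ih _) using 1
    · simp [add_comm]
    · simp

theorem reach_number (s : Bool) (column : Option Bool) (p : ℕ) (i r : List Sym) (t : List Cell)
    (k l : List Unit) (hi : i.head? ≠ some .tick) :
    Reach (2 * (p + 1))
      (config (some (.walk s column)) ⟨List.replicate p .tick ++ i, r, t, [], k, l, []⟩)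
      (config (some (afterNumber s i.head?))
        ⟨i.tail, i.head?.toList ++ (List.replicate p .tick ++ r),
          t.modifyHead (note s (t[p]?.any (· column))), [], k, l, []⟩) := by
  have hturn : Reach 1
      (config (some (.walk s column))
        ⟨i, List.replicate p .tick ++ r, t.drop p, (t.take p).reverse, k, l, []⟩)
      (config (some (.restore s (t[p]?.any (· column)) i.head?))
        ⟨i.tail, i.head?.toList ++ (List.replicate p .tick ++ r), t.drop p, (t.take p).reverse,
          k, l, []⟩) := by
    refine .of_stepAux ?_
    rw [← List.head?_drop]
    generalize t.drop p = u
    rcases i with _ | ⟨_ | _ | _, i⟩ <;> cases u <;> simp_all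
  have hrestore := reach_restore s (t[p]?.any (· column)) i.head? i.tail
    (i.head?.toList ++ (List.replicate p .tick ++ r)) (t.drop p) (t.take p).reverse k l
  rw [List.reverse_reverse, List.take_append_drop] at hrestore
  have hticks := reach_ticks s column p i r t [] k l
  rw [List.append_nil] at hticks
  refine ((hticks.trans hturn).trans hrestore).mono ?_
  simp only [List.length_reverse, List.length_take]
  omega

theorem note_false (s : Bool) : note s false = id := by
  funext a
  simp [note]

theorem note_comp_note_true (s b : Bool) : note s b ∘ note s true = note s true := by
  funext a
  simp [note]

theorem modifyHead_note_modifyHead_note (s b : Bool) (t : List Cell) (f : List Cell → Bool) :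
    (t.modifyHead (note s b)).modifyHead (note s (f (t.modifyHead (note s b)))) =
      t.modifyHead (note s (b || f t)) := by
  cases b
  · simp [note_false]
  · simp [note_comp_note_true]

theorem reach_encodeLinear (s : Bool) (column : Option Bool) (p : ℕ) (P : List ℕ)
    (i r : List Sym) (t : List Cell) (k l : List Unit) (hi : i.head? ≠ some .tick) :
    Reach (2 * ((encodeLinear p P).length + 1))
      (config (some (.walk s column)) ⟨encodeLinear p P ++ i, r, t, [], k, l, []⟩)
      (config (some (afterNumber s i.head?))
        ⟨i.tail, i.head?.toList ++ ((encodeLinear p P).reverse ++ r),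
          t.modifyHead (note s (t[p]?.any (· column) || P.any fun q => t[q]?.any (· (some s)))),
          [], k, l, []⟩) := by
  induction P generalizing p column r t with
  | nil => simpa [encodeLinear] using reach_number s column p i r t k l hi
  | cons q P ih =>
    have hfirst := reach_number s column p (.comma :: (encodeLinear q P ++ i)) r t k l (by simp)
    have hrest := ih (some s) q (.comma :: (List.replicate p .tick ++ r))
      (t.modifyHead (note s (t[p]?.any (· column))))
    rw [modifyHead_note_modifyHead_note s _ t fun t =>
      t[q]?.any (· (some s)) || P.any fun q => t[q]?.any (· (some s))] at hrest
    convert hfirst.trans hrest using 1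
    · simp only [encodeLinear, List.length_append, List.length_replicate, List.length_cons]
      ring
    · simp [encodeLinear]
    · simp [encodeLinear]

/-! ### Correctness and running time -/

open Classical in
/-- The correct table entry of `x` if `L false` and `L true` are the two linear sets. -/
noncomputable def row (L : Bool → Set ℕ) (x : ℕ) : Cell :=
  fun column => column.elim (x == 0) fun s => decide (x ∈ L s)

/-- The table of the correct entries of `x - 1, …, 0`. -/
noncomputable def rows (L : Bool → Set ℕ) : ℕ → List Cell
  | 0 => []
  | x + 1 => row L x :: rows L x

theorem length_rows (L : Bool → Set ℕ) (x : ℕ) : (rows L x).length = x := by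
  induction x with
  | zero => rfl
  | succ x ih => rw [rows, List.length_cons, ih]

theorem any_getElem?_rows (L : Bool → Set ℕ) (column : Option Bool) (x j : ℕ) :
    (rows L x)[j]?.any (· column) ↔ j < x ∧ row L (x - (j + 1)) column := by
  induction x generalizing j with
  | zero => simp [rows]
  | succ x ih => cases j <;> simp [rows, ih]

theorem any_getElem?_cons_rows_none (L : Bool → Set ℕ) {x p : ℕ} {a : Cell}
    (ha : a none = (x == 0)) : (a :: rows L x)[p]?.any (· none) ↔ p = x := by
  cases p with
  | zero => simpa [ha] using eq_comm
  | succ p =>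
    simp only [List.getElem?_cons_succ, any_getElem?_rows, row, Option.elim_none, beq_iff_eq]
    omega

theorem any_getElem?_cons_rows_some (L : Bool → Set ℕ) {s : Bool} {x p : ℕ} {a : Cell}
    (ha : a (some s) = false) :
    (a :: rows L x)[p]?.any (· (some s)) ↔ 0 < p ∧ p ≤ x ∧ x - p ∈ L s := by
  cases p with
  | zero => simp [ha]
  | succ p => simp [any_getElem?_rows, row]

theorem any_getElem?_or_any_eq_row {L : Bool → Set ℕ} {s : Bool} {c x : ℕ} {P : List ℕ} {a : Cell}
    (hL : L s = linearSet c P.toFinset) (hnone : a none = (x == 0)) (hs : a (some s) = false) :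
    ((a :: rows L x)[c]?.any (· none) || P.any fun p => (a :: rows L x)[p]?.any (· (some s))) =
      row L x (some s) := by
  rw [Bool.eq_iff_iff]
  simp only [Bool.or_eq_true, List.any_eq_true, any_getElem?_cons_rows_none L hnone,
    any_getElem?_cons_rows_some L hs, row, Option.elim_some, decide_eq_true_eq]
  rw [hL, mem_linearSet_iff_sub_mem]
  simp only [List.mem_toFinset]

theorem note_note_unmarked (L : Bool → Set ℕ) (x : ℕ) :
    note true (row L x (some true)) (note false (row L x (some false)) (unmarked (x == 0))) =
      row L x := by
  funext column
  rcases column with _ | _ | _ <;> simp [note, unmarked, row]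

theorem row_false_and_not_row_true_eq_false {L : Bool → Set ℕ} {x : ℕ}
    (hx : x ∈ L false → x ∈ L true) :
    (row L x (some false) && !row L x (some true)) = false := by
  simpa [row] using hx

section Instance

variable (c : Bool → ℕ) (P : Bool → List ℕ)

/-- The code of the instance with constant `c s` and list of periods `P s` on side `s`. -/
def code : List Sym := encodeInstance (c false) (P false) (c true) (P true)

/-- The linear set on side `s` of the instance. -/
def sideSet (s : Bool) : Set ℕ := linearSet (c s) (P s).toFinset

theorem reach_finish (x : ℕ) (k l : List Unit) :
    Reach (2 * ((code c P).length + 1))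
      (config (some (.walk false none))
        { input := code c P, table := unmarked (x == 0) :: rows (sideSet c P) x,
          inner := k, outer := l })
      (config (some .finish)
        { passed := (code c P).reverse, table := rows (sideSet c P) (x + 1),
          inner := k, outer := l }) := by
  have hleft := reach_encodeLinear false none (c false) (P false)
    (.semicolon :: encodeLinear (c true) (P true)) []
    (unmarked (x == 0) :: rows (sideSet c P) x) k l (by simp)
  have hright := reach_encodeLinear true none (c true) (P true) []
    (.semicolon :: (encodeLinear (c false) (P false)).reverse)
    (note false (row (sideSet c P) x (some false)) (unmarked (x == 0)) :: rows (sideSet c P) x)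
    k l (by simp)
  rw [any_getElem?_or_any_eq_row rfl rfl rfl, List.modifyHead_cons] at hleft hright
  rw [note_note_unmarked] at hright
  convert hleft.trans (by simpa [afterNumber] using hright) using 1
  · simp only [code, encodeInstance, List.length_append, List.length_cons]
    ring
  · simp [code, encodeInstance]
  · simp [code, encodeInstance, rows]

/-- The input word is on `input` and the two counters hold the digits of `r` to the base
`w.length + 1`. -/
def clocked (w : List Sym) (t : List Cell) (r : ℕ) : Store where
  input := w
  table := t
  inner := List.replicate (r % (w.length + 1)) ()
  outer := List.replicate (r / (w.length + 1)) ()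

theorem clocked_mul_add (w : List Sym) (t : List Cell) {i j : ℕ} (hj : j ≤ w.length) :
    clocked w t ((w.length + 1) * i + j) =
      { input := w, table := t, inner := List.replicate j (), outer := List.replicate i () } := by
  have hlt : j < w.length + 1 := Nat.lt_succ_of_le hj
  rw [clocked, Nat.mul_add_mod, Nat.mod_eq_of_lt hlt,
    Nat.mul_add_div w.length.succ_pos, Nat.div_eq_of_lt hlt, add_zero]

theorem reach_next_inner {x : ℕ} (hx : x ∈ sideSet c P false → x ∈ sideSet c P true)
    (k l : List Unit) :
    Reach (3 * (code c P).length + 4)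
      (config (some (.walk false none))
        { input := code c P, table := unmarked (x == 0) :: rows (sideSet c P) x,
          inner := () :: k, outer := l })
      (config (some (.walk false none))
        { input := code c P, table := unmarked false :: rows (sideSet c P) (x + 1),
          inner := k, outer := l }) := by
  have hturn : Reach 1
      (config (some .finish)
        { passed := (code c P).reverse, table := rows (sideSet c P) (x + 1),
          inner := () :: k, outer := l })
      (config (some (.rewind false))
        { passed := (code c P).reverse, table := unmarked false :: rows (sideSet c P) (x + 1),
          inner := k, outer := l }) :=
    .of_stepAux (by simp [rows, row_false_and_not_row_true_eq_false hx])
  have hrewind := reach_rewind (code c P).reverse [] (unmarked false :: rows (sideSet c P) (x + 1))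
    false k l
  convert ((reach_finish c P x _ _).trans hturn).trans hrewind using 1
  · rw [List.length_reverse]
    ring
  · simp

theorem reach_next_outer {x : ℕ} (hx : x ∈ sideSet c P false → x ∈ sideSet c P true)
    (l : List Unit) :
    Reach (3 * (code c P).length + 4)
      (config (some (.walk false none))
        { input := code c P, table := unmarked (x == 0) :: rows (sideSet c P) x,
          outer := () :: l })
      (config (some (.walk false none))
        { input := code c P, table := unmarked false :: rows (sideSet c P) (x + 1),
          inner := List.replicate (code c P).length (), outer := l }) := by
  have hturn : Reach 1
      (config (some .finish)
        { passed := (code c P).reverse, table := rows (sideSet c P) (x + 1), outer := () :: l })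
      (config (some (.rewind true))
        { passed := (code c P).reverse, table := unmarked false :: rows (sideSet c P) (x + 1),
          outer := l }) :=
    .of_stepAux (by simp [rows, row_false_and_not_row_true_eq_false hx])
  have hrewind := reach_rewind (code c P).reverse [] (unmarked false :: rows (sideSet c P) (x + 1))
    true [] l
  convert ((reach_finish c P x _ _).trans hturn).trans hrewind using 1
  · rw [List.length_reverse]
    ring
  · simp

theorem reach_next {x : ℕ} (hx : x ∈ sideSet c P false → x ∈ sideSet c P true) (r : ℕ) :
    Reach (3 * (code c P).length + 4)
      (config (some (.walk false none))
        (clocked (code c P) (unmarked (x == 0) :: rows (sideSet c P) x) (r + 1)))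
      (config (some (.walk false none))
        (clocked (code c P) (unmarked (x + 1 == 0) :: rows (sideSet c P) (x + 1)) r)) := by
  have hlt := Nat.mod_lt (r + 1) (code c P).length.succ_pos
  have hr := Nat.div_add_mod (r + 1) ((code c P).length + 1)
  generalize (r + 1) / ((code c P).length + 1) = i at hr
  generalize (r + 1) % ((code c P).length + 1) = j at hr hlt
  rw [← hr, clocked_mul_add _ _ (Nat.le_of_lt_succ hlt)]
  obtain _ | j := j
  · obtain _ | i := i
    · omega
    obtain rfl : r = ((code c P).length + 1) * i + (code c P).length := by lia
    rw [clocked_mul_add _ _ le_rfl]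
    exact reach_next_outer c P hx _
  · obtain rfl : r = ((code c P).length + 1) * i + j := by lia
    rw [clocked_mul_add _ _ (by lia)]
    exact reach_next_inner c P hx _ _

theorem reach_reject {x : ℕ} (hx : x ∈ sideSet c P false) (hx' : x ∉ sideSet c P true) (r : ℕ) :
    Reach (3 * (code c P).length + x + r + 4)
      (config (some (.walk false none))
        (clocked (code c P) (unmarked (x == 0) :: rows (sideSet c P) x) r))
      (config none { output := [false] }) := by
  have hturn (k l : List Unit) : Reach 1
      (config (some .finish)
        { passed := (code c P).reverse, table := rows (sideSet c P) (x + 1),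
          inner := k, outer := l })
      (config (some (.clear false))
        { passed := (code c P).reverse, table := rows (sideSet c P) x, inner := k, outer := l }) :=
    .of_stepAux (by simp [rows, row, hx, hx'])
  refine (((reach_finish c P x _ _).trans (hturn _ _)).trans
    (reach_clear false _ _ _ _ _ _)).mono ?_
  simp only [List.length_nil, List.length_reverse, List.length_replicate, length_rows]
  have hdigits : r % ((code c P).length + 1) + r / ((code c P).length + 1) ≤ r := by
    conv_rhs => rw [← Nat.mod_add_div r ((code c P).length + 1)]
    exact Nat.add_le_add_left (Nat.le_mul_of_pos_left _ (Nat.succ_pos _)) _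
  omega

theorem reach_accept {x : ℕ} (hx : x ∈ sideSet c P false → x ∈ sideSet c P true) :
    Reach (3 * (code c P).length + x + 6)
      (config (some (.walk false none))
        { input := code c P, table := unmarked (x == 0) :: rows (sideSet c P) x })
      (config none { output := [true] }) := by
  have hturn : Reach 1
      (config (some .finish)
        { passed := (code c P).reverse, table := rows (sideSet c P) (x + 1) })
      (config (some (.clear true))
        { passed := (code c P).reverse, table := unmarked false :: rows (sideSet c P) (x + 1) }) :=
    .of_stepAux (by simp [rows, row_false_and_not_row_true_eq_false hx])
  convert ((reach_finish c P x [] []).trans hturn).trans (reach_clear true _ _ _ _ _ _) using 1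
  simp only [List.length_nil, List.length_cons, List.length_reverse, length_rows]
  ring

theorem le_length_encodeLinear (c : ℕ) (P : List ℕ) :
    c ≤ (encodeLinear c P).length ∧ ∀ p ∈ P, p ≤ (encodeLinear c P).length := by
  induction P generalizing c with
  | nil => simp [encodeLinear]
  | cons q P ih =>
    obtain ⟨hq, hP⟩ := ih q
    simp only [encodeLinear, List.length_append, List.length_replicate, List.length_cons,
      List.forall_mem_cons]
    exact ⟨by omega, by omega, fun p hp => (hP p hp).trans (by omega)⟩

theorem sideSet_subset_of_forall_lt
    (h : ∀ x < ((code c P).length + 1) ^ 2, x ∈ sideSet c P false → x ∈ sideSet c P true) :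
    sideSet c P false ⊆ sideSet c P true := by
  obtain ⟨hc, hP⟩ := le_length_encodeLinear (c false) (P false)
  have hP' := (le_length_encodeLinear (c true) (P true)).2
  have hlen : (code c P).length =
      (encodeLinear (c false) (P false)).length + (encodeLinear (c true) (P true)).length + 1 := by
    simp [code, encodeInstance, add_assoc]
  exact linearSet_subset_of_forall_lt (by omega)
    (fun p hp => (hP p (List.mem_toFinset.mp hp)).trans (by omega))
    (fun p hp => (hP' p (List.mem_toFinset.mp hp)).trans (by omega)) h

open Classical in
theorem reach_search {x r : ℕ} (hr : x + r + 1 = ((code c P).length + 1) ^ 2)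
    (hlt : ∀ y < x, y ∈ sideSet c P false → y ∈ sideSet c P true) :
    Reach (r * (3 * (code c P).length + 4) + 3 * (code c P).length +
        ((code c P).length + 1) ^ 2 + 5)
      (config (some (.walk false none))
        (clocked (code c P) (unmarked (x == 0) :: rows (sideSet c P) x) r))
      (config none { output := [decide (sideSet c P false ⊆ sideSet c P true)] }) := by
  induction r generalizing x with
  | zero =>
    by_cases hx : x ∈ sideSet c P false → x ∈ sideSet c P true
    · have hsub : sideSet c P false ⊆ sideSet c P true :=
        sideSet_subset_of_forall_lt c P (hr ▸ Nat.forall_lt_succ_right.mpr ⟨hlt, hx⟩)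
      rw [decide_eq_true hsub]
      exact .mono (by simpa [clocked] using reach_accept c P hx) (by omega)
    · obtain ⟨hx, hx'⟩ := Classical.not_imp.mp hx
      rw [decide_eq_false fun hsub => hx' (hsub hx)]
      exact (reach_reject c P hx hx' _).mono (by lia)
  | succ r ih =>
    by_cases hx : x ∈ sideSet c P false → x ∈ sideSet c P true
    · have hrest := ih (by omega) (Nat.forall_lt_succ_right.mpr ⟨hlt, hx⟩)
      exact ((reach_next c P hx r).trans hrest).mono (by lia)
    · obtain ⟨hx, hx'⟩ := Classical.not_imp.mp hx
      rw [decide_eq_false fun hsub => hx' (hsub hx)]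
      exact (reach_reject c P hx hx' _).mono (by lia)

end Instance

theorem count_encodeLinear (c : ℕ) (P : List ℕ) : (encodeLinear c P).count .semicolon = 0 := by
  induction P generalizing c with
  | nil => simp [encodeLinear, List.count_replicate]
  | cons p P ih => simp [encodeLinear, List.count_replicate, ih]

theorem count_encodeInstance (c : ℕ) (P : List ℕ) (c' : ℕ) (P' : List ℕ) :
    (encodeInstance c P c' P').count .semicolon = 1 := by
  simp [encodeInstance, count_encodeLinear]

theorem count_of_mem_unaryContainment {w : List Sym} (hw : w ∈ unaryContainment) :
    w.count .semicolon = 1 := by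
  obtain ⟨c, P, c', P', rfl, -⟩ := hw
  exact count_encodeInstance c P c' P'

theorem exists_eq_encodeLinear {u : List Sym} (hu : .semicolon ∉ u) :
    ∃ c P, u = encodeLinear c P := by
  induction u with
  | nil => exact ⟨0, [], rfl⟩
  | cons s u ih =>
    obtain ⟨c, P, rfl⟩ := ih fun h => hu (List.mem_cons_of_mem _ h)
    cases s with
    | tick => exact ⟨c + 1, P, by cases P <;> simp [encodeLinear, List.replicate_succ]⟩
    | comma => exact ⟨0, c :: P, rfl⟩
    | semicolon => simp at hu

theorem exists_eq_encodeInstance {w : List Sym} (hw : w.count .semicolon = 1) :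
    ∃ c P c' P', w = encodeInstance c P c' P' := by
  obtain ⟨u, v, rfl⟩ := List.append_of_mem (List.count_pos_iff.mp (by rw [hw]; exact one_pos))
  simp only [List.count_append, List.count_cons_self] at hw
  obtain ⟨c, P, rfl⟩ := exists_eq_encodeLinear (List.count_eq_zero.mp (show u.count _ = 0 by omega))
  obtain ⟨c', P', rfl⟩ :=
    exists_eq_encodeLinear (List.count_eq_zero.mp (show v.count _ = 0 by omega))
  exact ⟨c, P, c', P', rfl⟩

theorem exists_eq_code {w : List Sym} (hw : w.count .semicolon = 1) :
    ∃ c P, w = code c P ∧ (w ∈ unaryContainment ↔ sideSet c P false ⊆ sideSet c P true) := by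
  -- Taking the instance from `hmem` avoids proving that the encoding is injective.
  by_cases hmem : w ∈ unaryContainment
  · obtain ⟨c, P, c', P', rfl, hsub⟩ := id hmem
    exact ⟨fun s => bif s then c' else c, fun s => bif s then P' else P, rfl,
      iff_of_true hmem hsub⟩
  · obtain ⟨c, P, c', P', rfl⟩ := exists_eq_encodeInstance hw
    exact ⟨fun s => bif s then c' else c, fun s => bif s then P' else P, rfl,
      iff_of_false hmem fun hsub => hmem ⟨c, P, c', P', rfl, hsub⟩⟩

/-- The running time of the machine on inputs of length `X`: at most `X ^ 2 + 2 * X + 1` numbers are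
tested. -/
noncomputable def timeBound : Polynomial ℕ :=
  (.X ^ 2 + 2 * .X) * (3 * .X + 5) + 5 * .X + 8

theorem eval_timeBound (n : ℕ) :
    timeBound.eval n = (n ^ 2 + 2 * n) * (3 * n + 5) + 5 * n + 8 := by
  simp [timeBound]

theorem reach_scan_input (w : List Sym) :
    Reach w.length (config (some .scan) { input := w })
      (config (some .scan)
        { passed := w.reverse, inner := List.replicate (w.count .semicolon) (),
          outer := List.replicate w.length () }) := by
  simpa using reach_scan w [] [] []

open Classical in
theorem reach_decide_code (c : Bool → ℕ) (P : Bool → List ℕ) :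
    Reach (timeBound.eval (code c P).length) (config (some .scan) { input := code c P })
      (config none { output := [decide (sideSet c P false ⊆ sideSet c P true)] }) := by
  have hscan := reach_scan_input (code c P)
  rw [code, count_encodeInstance, ← code] at hscan
  have hstart : Reach 1
      (config (some .scan)
        { passed := (code c P).reverse, inner := [()],
          outer := List.replicate (code c P).length () })
      (config (some (.rewind true))
        { passed := (code c P).reverse, table := [unmarked true],
          outer := List.replicate (code c P).length () }) :=
    .of_stepAux (by simp)
  have hrewind := reach_rewind (code c P).reverse [] [unmarked true] true []
    (List.replicate (code c P).length ())
  have hsearch := reach_search c P (x := 0)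
    (r := ((code c P).length + 1) * (code c P).length + (code c P).length) (by ring) (by simp)
  rw [clocked_mul_add _ _ le_rfl] at hsearch
  refine (((hscan.trans hstart).trans hrewind).trans (by simpa [rows] using hsearch)).mono ?_
  rw [List.length_reverse, eval_timeBound]
  lia

theorem reach_reject_of_count_ne_one {w : List Sym} (hw : w.count .semicolon ≠ 1) :
    Reach (timeBound.eval w.length) (config (some .scan) { input := w })
      (config none { output := [false] }) := by
  have hreject : Reach 1
      (config (some .scan)
        { passed := w.reverse, inner := List.replicate (w.count .semicolon) (),
          outer := List.replicate w.length () })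
      (config (some (.clear false))
        { passed := w.reverse, inner := List.replicate (w.count .semicolon - 2) (),
          outer := List.replicate w.length () }) := by
    refine .of_stepAux ?_
    generalize w.count .semicolon = m at hw
    rcases m with _ | _ | m
    · simp
    · contradiction
    · simp [List.replicate_succ]
  refine (((reach_scan_input w).trans hreject).trans (reach_clear false _ _ _ _ _ _)).mono ?_
  have hcount : w.count .semicolon ≤ w.length := List.count_le_length
  simp only [List.length_nil, List.length_reverse, List.length_replicate, eval_timeBound]
  lia

open Classical in
theorem reach_decide (w : List Sym) :
    Reach (timeBound.eval w.length) (config (some .scan) { input := w })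
      (config none { output := [decide (w ∈ unaryContainment)] }) := by
  by_cases hw : w.count .semicolon = 1
  · obtain ⟨c, P, rfl, hmem⟩ := exists_eq_code hw
    rw [decide_eq_decide.mpr hmem]
    exact reach_decide_code c P
  · rw [decide_eq_false (mt count_of_mem_unaryContainment hw)]
    exact reach_reject_of_count_ne_one hw

theorem initList_machine (w : List Sym) :
    Turing.initList machine w = config (some .scan) { input := w } := by
  unfold Turing.initList config
  congr 1
  funext k
  cases k <;> rfl

theorem haltList_machine (o : List Bool) :
    Turing.haltList machine o = config none { output := o } := by
  unfold Turing.haltList config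
  congr 1
  funext k
  cases k <;> rfl

open Classical in
theorem machine_outputsInTime (w : List Sym) :
    Nonempty (Turing.TM2OutputsInTime machine w
      (some (Computability.encodeBool (decide (w ∈ unaryContainment))))
      (timeBound.eval w.length)) := by
  have h := reach_decide w
  rw [← initList_machine, ← haltList_machine] at h
  exact h

end Machine

end LinearSetContainment

theorem theorem3p5 : LinearSetContainment.InP LinearSetContainment.unaryContainment := by
  refine ⟨{ tm := LinearSetContainment.machine
            inputAlphabet := Equiv.refl LinearSetContainment.Sym
            outputAlphabet := Equiv.refl Bool
            time := LinearSetContainment.timeBound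
            outputsFun := fun w => Nonempty.some ?_ },
    fun k : LinearSetContainment.Stack => Finite.of_fintype (LinearSetContainment.Alphabet k)⟩
  exact (congrArg (fun v : List LinearSetContainment.Sym =>
      Nonempty (Turing.TM2OutputsInTime LinearSetContainment.machine v _ _)) (List.map_id w)).mpr
    (LinearSetContainment.machine_outputsInTime w)
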